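/- Let $P$ be a finite poset and let $$\mathcal C(P)=\Bigl\{a\in\mathbb R^P : a_x\ge 0 \text{ for all } x\in P,\ \ a_{x_1}+\cdots+a_{x_k}\le 1 \text{ for every maximal chain } x_1<\cdots<x_k \text{ of } P\Bigr\}$$ be its chain polytope. Then $\mathcal C(P)$ has a regular unimodular triangulation that is a flag complex. That is, there is a finite geometric simplicial complex $\Delta$ in $\mathbb R^P$ with underlying space $\mathcal C(P)$, all of whose vertices lie in $A=\mathcal C(P)\cap\mathbb Z^P$, such that: (i) (regular) there is a height function $\omega:A\to\mathbb R$ such that a nonempty subset $\sigma\subseteq A$ is the vertex set of a simplex of $\Delta$ if and only if some affine function $\ell:\mathbb R^P\to\mathbb R$ satisfies $\ell(a)=\omega(a)$ for $a\in\sigma$ and $\ell(a)<\omega(a)$ for $a\in A\setminus\sigma$; (ii) (unimodular) for every maximal simplex of $\Delta$, the differences of its vertices generate the lattice $\mathbb Z^P$; (iii) (flag) every nonempty finite set of vertices of $\Delta$, any two of which are joined by an edge of $\Delta$, is the vertex set of a simplex of $\Delta$. -/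

import Mathlib

/-- The chain polytope of a finite poset `P`: the points of `ℝ^P` with nonnegative coordinates
whose coordinates sum to at most `1` along every maximal chain of `P`. -/
def chainPolytope (P : Type*) [PartialOrder P] [Fintype P] : Set (P → ℝ) :=
  {a | (∀ i, 0 ≤ a i) ∧ ∀ c : Finset P, IsMaxChain (· ≤ ·) (c : Set P) → ∑ i ∈ c, a i ≤ 1}

/-- The lattice `ℤ^ι` inside `ℝ^ι`. -/
def integerLattice (ι : Type*) : AddSubgroup (ι → ℝ) where
  carrier := {x | ∀ i, ∃ n : ℤ, x i = n}
  zero_mem' := fun _ => ⟨0, by simp⟩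
  add_mem' := by
    intro x y hx hy i
    obtain ⟨m, hm⟩ := hx i
    obtain ⟨n, hn⟩ := hy i
    exact ⟨m + n, by simp [hm, hn]⟩
  neg_mem' := by
    intro x hx i
    obtain ⟨m, hm⟩ := hx i
    exact ⟨-m, by simp [hm]⟩

/-- The lattice points of a subset `Q` of `ℝ^ι`. -/
def latticePoints {ι : Type*} (Q : Set (ι → ℝ)) : Set (ι → ℝ) :=
  Q ∩ integerLattice ι

/-- `K` is a (lattice) triangulation of `Q`: a finite geometric simplicial complex whose
underlying space is `Q` and all of whose vertices are lattice points of `Q`. -/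
structure IsTriangulation {ι : Type*} (Q : Set (ι → ℝ))
    (K : Geometry.SimplicialComplex ℝ (ι → ℝ)) : Prop where
  finite : K.faces.Finite
  space_eq : K.space = Q
  vertices_subset : K.vertices ⊆ latticePoints Q

/-- `K` is unimodular in the full-dimensional sense: for every maximal simplex `s` of `K`, the
vertices of `s` are lattice points, and the differences of vertices of `s` generate the whole
lattice `ℤ^ι`. As the vertices of `s` are affinely independent, this says that
`v₁ - v₀, …, v_d - v₀` is a `ℤ`-basis of `ℤ^ι`, that is, `s` has normalized volume one. -/
def IsUnimodular {ι : Type*} (K : Geometry.SimplicialComplex ℝ (ι → ℝ)) : Prop :=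
  ∀ s ∈ K.facets, (s : Set (ι → ℝ)) ⊆ integerLattice ι ∧
    AddSubgroup.closure {x | ∃ v ∈ s, ∃ w ∈ s, x = v - w} = integerLattice ι

/-- `K` is regular (or coherent) with respect to the point configuration `A`: for some heights
`ω` on `A`, the simplices of `K` are exactly the nonempty sets `s` of points of `A` over which the
lower hull of the lifted points `(a, ω a)` has a face. That is, some affine function `l` agrees
with `ω` on `s` and is strictly below `ω` on the rest of `A`. -/
def IsRegularTriangulation {ι : Type*} (A : Set (ι → ℝ)) (K : Geometry.SimplicialComplex ℝ (ι → ℝ)) : Prop :=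
  ∃ ω : (ι → ℝ) → ℝ, ∀ s : Finset (ι → ℝ), s ∈ K.faces ↔
    s.Nonempty ∧ (s : Set (ι → ℝ)) ⊆ A ∧
      ∃ l : (ι → ℝ) →ᵃ[ℝ] ℝ, (∀ a ∈ s, l a = ω a) ∧ ∀ a ∈ A, a ∉ s → l a < ω a

/-- `K` is a flag complex: a nonempty finite set is a simplex as soon as its points are vertices
and any two of them span an edge. (By downward closure, `v` and `w` lie in a common simplex iff
`{v, w}` is a simplex; the case `v = w` says that `v` is a vertex.) -/
def IsFlag {ι : Type*} (K : Geometry.SimplicialComplex ℝ (ι → ℝ)) : Prop :=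
  ∀ s : Finset (ι → ℝ), s.Nonempty →
    (∀ v ∈ s, ∀ w ∈ s, ∃ e ∈ K.faces, v ∈ e ∧ w ∈ e) → s ∈ K.faces

/-! The lattice points of the polytope are the indicators of antichains, so they correspond to lower
sets `I` through their maximal elements. The simplices are taken to be the chains of lower sets;
flagness is then immediate.

Regularity rests on the straightening law `exists_vertexPoint_add_eq`: the points of `I` and `J`
have the same sum as those of `I ⊔ J` and some `K ≤ I ⊓ J`. A strictly concave, increasing height in
the cardinality makes the right side strictly lower when `I`, `J` are incomparable, so they never
share a cell. Conversely, affine functions can be prescribed on a chain, and the law propagates the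
strict inequality to all other lower sets (`IsMaxChain.lt_lowerSetHeight`). The supporting functions
also make simplices meet in common faces.

Covering is greedy: subtract from `a` a multiple of the point of the lower set generated by its
support (`exists_chain_decomposition`). Unimodularity holds because a maximal chain of lower sets
adds one element at a time. -/

theorem AffineMap.map_add_eq_of_add_eq {E : Type*} [AddCommGroup E] [Module ℝ E]
    (l : E →ᵃ[ℝ] ℝ) {a b c d : E} (h : a + b = c + d) : l a + l b = l c + l d := by
  have hlin := congrArg l.linear h
  rw [map_add, map_add] at hlin
  have hdec : ∀ x, l x = l.linear x + l 0 := fun x => congrFun l.decomp x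
  rw [hdec a, hdec b, hdec c, hdec d]
  linarith

/-! ### Lower sets, straightening and heights -/

section LowerSets

variable {P : Type*} [PartialOrder P]

instance LowerSet.instFinite [Finite P] : Finite (LowerSet P) :=
  Finite.of_injective _ (SetLike.coe_injective (A := LowerSet P) (B := P))

open Classical in
/-- The indicator vector of the antichain of maximal elements of a lower set. -/
noncomputable def vertexPoint (I : LowerSet P) : P → ℝ :=
  fun p => if Maximal (· ∈ I) p then 1 else 0

theorem vertexPoint_of_maximal {I : LowerSet P} {p : P} (h : Maximal (· ∈ I) p) :
    vertexPoint I p = 1 := if_pos h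

theorem vertexPoint_of_not_maximal {I : LowerSet P} {p : P} (h : ¬ Maximal (· ∈ I) p) :
    vertexPoint I p = 0 := if_neg h

theorem vertexPoint_of_notMem {I : LowerSet P} {p : P} (h : p ∉ I) : vertexPoint I p = 0 :=
  vertexPoint_of_not_maximal fun hp => h hp.1

theorem vertexPoint_bot : vertexPoint (⊥ : LowerSet P) = 0 :=
  funext fun _ => vertexPoint_of_notMem (by simp)

theorem vertexPoint_ne_zero_iff {I : LowerSet P} {p : P} :
    vertexPoint I p ≠ 0 ↔ Maximal (· ∈ I) p := by
  unfold vertexPoint; split_ifs with h <;> simp [h]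

theorem vertexPoint_nonneg (I : LowerSet P) (p : P) : 0 ≤ vertexPoint I p := by
  unfold vertexPoint; split_ifs <;> simp

theorem exists_maximal_ge_of_mem [Finite P] {I : LowerSet P} {p : P} (hp : p ∈ I) :
    ∃ q, p ≤ q ∧ Maximal (· ∈ I) q :=
  (Set.toFinite (I : Set P)).exists_le_maximal hp

theorem lowerClosure_vertexPoint_ne_zero [Finite P] (I : LowerSet P) :
    lowerClosure {p | vertexPoint I p ≠ 0} = I := by
  ext p
  simp only [SetLike.mem_coe, mem_lowerClosure]
  constructor
  · rintro ⟨q, hq, hpq⟩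
    exact I.lower hpq (vertexPoint_ne_zero_iff.1 hq).1
  · intro hp
    obtain ⟨q, hpq, hq⟩ := exists_maximal_ge_of_mem hp
    exact ⟨q, vertexPoint_ne_zero_iff.2 hq, hpq⟩

theorem vertexPoint_injective [Finite P] :
    Function.Injective (vertexPoint : LowerSet P → P → ℝ) := fun I J h => by
  rw [← lowerClosure_vertexPoint_ne_zero I, h, lowerClosure_vertexPoint_ne_zero]

theorem maximal_mem_lowerClosure_iff {A : Set P} (hA : IsAntichain (· ≤ ·) A) {p : P} :
    Maximal (· ∈ lowerClosure A) p ↔ p ∈ A := by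
  constructor
  · rintro ⟨⟨q, hq, hpq⟩, h⟩
    have : q ≤ p := h (subset_lowerClosure hq) hpq
    exact le_antisymm hpq this ▸ hq
  · refine fun hp => ⟨subset_lowerClosure hp, ?_⟩
    rintro q ⟨r, hr, hqr⟩ hpq
    rwa [hA.eq hp hr (hpq.trans hqr)]

open Classical in
theorem vertexPoint_lowerClosure {A : Set P} (hA : IsAntichain (· ≤ ·) A) (p : P) :
    vertexPoint (lowerClosure A) p = if p ∈ A then 1 else 0 := by
  simp only [vertexPoint, maximal_mem_lowerClosure_iff hA]

theorem exists_maximal_notMem [Finite P] {I J : LowerSet P} (h : ¬ I ≤ J) :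
    ∃ p, Maximal (· ∈ I) p ∧ p ∉ J := by
  obtain ⟨p, hp, hpJ⟩ := Set.not_subset.1 h
  obtain ⟨q, hpq, hq⟩ := exists_maximal_ge_of_mem hp
  exact ⟨q, hq, fun hqJ => hpJ (J.lower hpq hqJ)⟩

/-- The straightening law for antichains. -/
theorem exists_vertexPoint_add_eq (I J : LowerSet P) :
    ∃ K ≤ I ⊓ J, vertexPoint I + vertexPoint J = vertexPoint (I ⊔ J) + vertexPoint K := by
  classical
  -- `R` collects the coordinates not accounted for by `I ⊔ J`: the second 1 where `p` is maximal in
  -- both, and the 1 of a `p` maximal in one set but not maximal in the other, which contains it.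
  set R : Set P := {p | (p ∈ I ∧ p ∈ J) ∧ (Maximal (· ∈ I) p ∨ Maximal (· ∈ J) p)} with hR
  have hanti : IsAntichain (· ≤ ·) R := by
    rintro p ⟨-, hp⟩ q ⟨⟨hqI, hqJ⟩, -⟩ hne hpq
    rcases hp with hp | hp
    · exact hne (le_antisymm hpq (hp.2 hqI hpq))
    · exact hne (le_antisymm hpq (hp.2 hqJ hpq))
  refine ⟨lowerClosure R, lowerClosure_le.2 fun p hp => hp.1, funext fun p => ?_⟩
  have hsup : Maximal (· ∈ I ⊔ J) p ↔
      (Maximal (· ∈ I) p ∨ Maximal (· ∈ J) p) ∧ (p ∈ I → Maximal (· ∈ I) p) ∧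
        (p ∈ J → Maximal (· ∈ J) p) := by
    have hI : ∀ q, p ≤ q → q ∈ I → p ∈ I := fun q hpq hq => I.lower hpq hq
    have hJ : ∀ q, p ≤ q → q ∈ J → p ∈ J := fun q hpq hq => J.lower hpq hq
    simp only [Maximal, LowerSet.mem_sup_iff]
    clear hanti hR
    grind
  simp only [Pi.add_apply, vertexPoint_lowerClosure hanti]
  have hI : Maximal (· ∈ I) p → p ∈ I := fun h => h.1
  have hJ : Maximal (· ∈ J) p → p ∈ J := fun h => h.1
  simp only [vertexPoint, hsup, hR, Set.mem_ofPred_eq]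
  by_cases h1 : Maximal (· ∈ I) p <;> by_cases h2 : Maximal (· ∈ J) p <;>
    by_cases h3 : p ∈ I <;> by_cases h4 : p ∈ J <;> simp_all

/-- A strictly concave increasing function of the cardinality of a lower set. -/
noncomputable def lowerSetHeight (I : LowerSet P) : ℝ :=
  2 * Nat.card P * (I : Set P).ncard - ((I : Set P).ncard : ℝ) ^ 2

/-- Concavity gains twice the product of the sizes of `I \ J` and `J \ I`, hence at least 2.
Shrinking `I ⊓ J` to `K` only lowers the height, since it increases up to cardinality `Nat.card P`.
The gap 1 leaves room for the slack 1/2 used below. -/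
theorem lowerSetHeight_add_le [Finite P] {I J K : LowerSet P} (hIJ : ¬ I ≤ J) (hJI : ¬ J ≤ I)
    (hK : K ≤ I ⊓ J) :
    lowerSetHeight (I ⊔ J) + lowerSetHeight K + 1 ≤ lowerSetHeight I + lowerSetHeight J := by
  have hcard : ((I ⊔ J : LowerSet P) : Set P).ncard + ((I ⊓ J : LowerSet P) : Set P).ncard
      = (I : Set P).ncard + (J : Set P).ncard := by
    rw [LowerSet.coe_sup, LowerSet.coe_inf]
    exact Set.ncard_union_add_ncard_inter _ _
  have hI : ((I ⊓ J : LowerSet P) : Set P).ncard + 1 ≤ (I : Set P).ncard :=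
    Set.ncard_lt_ncard (LowerSet.coe_ssubset_coe.2 (inf_lt_left.2 hIJ))
  have hJ : ((I ⊓ J : LowerSet P) : Set P).ncard + 1 ≤ (J : Set P).ncard :=
    Set.ncard_lt_ncard (LowerSet.coe_ssubset_coe.2 (inf_lt_right.2 hJI))
  have hk : (K : Set P).ncard ≤ ((I ⊓ J : LowerSet P) : Set P).ncard :=
    Set.ncard_le_ncard hK
  have hn : ((I ⊓ J : LowerSet P) : Set P).ncard ≤ Nat.card P := by
    rw [← Set.ncard_univ]; exact Set.ncard_le_ncard (Set.subset_univ _)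
  unfold lowerSetHeight
  generalize ((I ⊔ J : LowerSet P) : Set P).ncard = u at *
  generalize ((I ⊓ J : LowerSet P) : Set P).ncard = m at *
  generalize (K : Set P).ncard = k at *
  generalize (I : Set P).ncard = i at *
  generalize (J : Set P).ncard = j at *
  generalize Nat.card P = n at *
  obtain ⟨a, rfl⟩ := Nat.exists_eq_add_of_le hI
  obtain ⟨b, rfl⟩ := Nat.exists_eq_add_of_le hJ
  obtain ⟨c, rfl⟩ := Nat.exists_eq_add_of_le hk
  obtain ⟨d, rfl⟩ := Nat.exists_eq_add_of_le hn
  obtain rfl : u = k + c + 1 + a + 1 + b := by omega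
  push_cast
  have ha : (0 : ℝ) ≤ a := a.cast_nonneg
  have hb : (0 : ℝ) ≤ b := b.cast_nonneg
  have hc : (0 : ℝ) ≤ c := c.cast_nonneg
  have hd : (0 : ℝ) ≤ d := d.cast_nonneg
  nlinarith [mul_nonneg ha hb, mul_nonneg hc hd, mul_nonneg hc hc]

/-- Affine functions take arbitrary values on the points of a chain of lower sets. -/
theorem exists_affineMap_vertexPoint_eq [Fintype P] (C : Finset (LowerSet P))
    (hC : IsChain (· ≤ ·) (C : Set (LowerSet P))) (g : LowerSet P → ℝ) :
    ∃ l : (P → ℝ) →ᵃ[ℝ] ℝ, ∀ I ∈ C, l (vertexPoint I) = g I := by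
  classical
  induction C using Finset.strongInduction with
  | H C ih =>
  rcases C.eq_empty_or_nonempty with rfl | hne
  · exact ⟨0, by simp⟩
  obtain ⟨B, hB⟩ := C.exists_maximal hne
  have hlt : ∀ I ∈ C.erase B, I < B := fun I hI => by
    rw [Finset.mem_erase] at hI
    refine lt_of_le_of_ne ?_ hI.1
    rcases hC.total hI.2 hB.1 with h | h
    · exact h
    · exact hB.2 hI.2 h
  have hsub := Finset.erase_ssubset hB.1
  obtain ⟨l, hl⟩ := ih _ hsub (hC.mono (by simp))
  rcases (C.erase B).eq_empty_or_nonempty with he | hne'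
  · refine ⟨AffineMap.const ℝ _ (g B), fun I hI => ?_⟩
    by_cases h : I = B
    · simp [h]
    · exact absurd (Finset.mem_erase.2 ⟨h, hI⟩) (by simp [he])
  obtain ⟨J, hJ⟩ := (C.erase B).exists_maximal hne'
  -- The system is triangular: coordinate `p` is 1 at the point of `B` and 0 at every smaller
  -- member, so it corrects the value at `B` alone.
  obtain ⟨p, hp, hpJ⟩ := exists_maximal_notMem (hlt J hJ.1).not_ge
  refine ⟨l + (g B - l (vertexPoint B)) • (LinearMap.proj p : (P → ℝ) →ₗ[ℝ] ℝ).toAffineMap,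
    fun I hI => ?_⟩
  by_cases h : I = B
  · subst h
    simp [vertexPoint_of_maximal hp]
  · have hI' := Finset.mem_erase.2 ⟨h, hI⟩
    have hIJ : I ≤ J := by
      rcases hC.total hI (Finset.mem_erase.1 hJ.1).2 with h | h
      · exact h
      · exact hJ.2 hI' h
    have : p ∉ I := fun hpI => hpJ (hIJ hpI)
    simp [vertexPoint_of_notMem this, hl I hI']

/-- In a maximal chain of lower sets, every nonempty member has an immediate predecessor. -/
theorem IsMaxChain.exists_pred [Finite P] {C : Set (LowerSet P)} (hC : IsMaxChain (· ≤ ·) C)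
    {B : LowerSet P} (hB : B ∈ C) (hne : B ≠ ⊥) :
    ∃ J ∈ C, J < B ∧ ∀ K, J ≤ K → K ≤ B → K = J ∨ K = B := by
  obtain ⟨J, hJ⟩ := (Set.toFinite {I | I ∈ C ∧ I < B}).exists_maximal
    ⟨⊥, hC.bot_mem, bot_lt_iff_ne_bot.2 hne⟩
  refine ⟨J, hJ.1.1, hJ.1.2, fun K hJK hKB => ?_⟩
  by_contra! hcon
  have hKC : K ∈ C := by
    have hins : IsChain (· ≤ ·) (insert K C) := by
      refine hC.isChain.insert fun I hI _ => ?_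
      rcases hC.isChain.total hI hB with h | h
      · rcases h.eq_or_lt with rfl | h
        · exact Or.inl hKB
        rcases hC.isChain.total hI hJ.1.1 with h' | h'
        · exact Or.inr (h'.trans hJK)
        · exact Or.inr ((hJ.2 ⟨hI, h⟩ h').trans hJK)
      · exact Or.inl (hKB.trans h)
    rw [hC.2 hins (Set.subset_insert _ _)]
    exact Set.mem_insert _ _
  exact hcon.1 (le_antisymm (hJ.2 ⟨hKC, lt_of_le_of_ne hKB hcon.2⟩ hJK) hJK)

/-- An affine function below the heights on the points of a maximal chain of lower sets, by at most
`1/2`, is strictly below the heights elsewhere. -/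
theorem IsMaxChain.lt_lowerSetHeight [Finite P] {C : Set (LowerSet P)}
    (hC : IsMaxChain (· ≤ ·) C) (l : (P → ℝ) →ᵃ[ℝ] ℝ)
    (hle : ∀ I ∈ C, l (vertexPoint I) ≤ lowerSetHeight I)
    (hge : ∀ I ∈ C, lowerSetHeight I - 1 / 2 ≤ l (vertexPoint I)) (I : LowerSet P) (hI : I ∉ C) :
    l (vertexPoint I) < lowerSetHeight I := by
  induction I using WellFoundedLT.induction with
  | ind I ih =>
  -- With `B` the least member containing `I` and `J` its predecessor, `I ⊔ J = B`. Straightening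
  -- then expresses `l` at `I` through `B`, `J` in the chain and a smaller `K`.
  obtain ⟨B, hB⟩ := (Set.toFinite {B | B ∈ C ∧ I ≤ B}).exists_minimal ⟨⊤, hC.top_mem, le_top⟩
  have hIB : I ≠ B := fun h => hI (h ▸ hB.1.1)
  have hBbot : B ≠ ⊥ := fun h => hIB (le_antisymm hB.1.2 (h ▸ bot_le))
  obtain ⟨J, hJC, hJB, hcov⟩ := hC.exists_pred hB.1.1 hBbot
  have hIJ : ¬ I ≤ J := fun h => (hB.2 ⟨hJC, h⟩ hJB.le).not_gt hJB
  have hsup : I ⊔ J = B :=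
    (hcov _ le_sup_right (sup_le hB.1.2 hJB.le)).resolve_left fun h => hIJ (sup_eq_right.1 h)
  have hJI : ¬ J ≤ I := fun h => hIB (by rw [← hsup, sup_eq_left.2 h])
  obtain ⟨K, hK, hadd⟩ := exists_vertexPoint_add_eq I J
  have hKI : K < I := hK.trans_lt (inf_lt_left.2 hIJ)
  have hKle : l (vertexPoint K) ≤ lowerSetHeight K := by
    by_cases h : K ∈ C
    · exact hle K h
    · exact (ih K hKI h).le
  have hht := lowerSetHeight_add_le hIJ hJI hK
  have hl : l (vertexPoint I) + l (vertexPoint J) = l (vertexPoint (I ⊔ J)) + l (vertexPoint K) :=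
    l.map_add_eq_of_add_eq hadd
  rw [hsup] at hl hht
  -- The error at `J` is at most 1/2, less than the gap 1.
  linarith [hle B hB.1.1, hge J hJC]

/-- Every chain of lower sets is cut out by a supporting affine function of the heights. -/
theorem IsChain.exists_support [Fintype P] {C : Set (LowerSet P)} (hC : IsChain (· ≤ ·) C) :
    ∃ l : (P → ℝ) →ᵃ[ℝ] ℝ, (∀ I ∈ C, l (vertexPoint I) = lowerSetHeight I) ∧
      ∀ I ∉ C, l (vertexPoint I) < lowerSetHeight I := by
  classical
  obtain ⟨D, hD, hCD⟩ := hC.exists_maxChain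
  -- Lowering by 1/2 on `D \ C` makes the inequality strict there, within the tolerance of
  -- `IsMaxChain.lt_lowerSetHeight`.
  obtain ⟨l, hl⟩ := exists_affineMap_vertexPoint_eq D.toFinite.toFinset (by simpa using hD.isChain)
    fun I => if I ∈ C then lowerSetHeight I else lowerSetHeight I - 1 / 2
  simp only [Set.Finite.mem_toFinset] at hl
  refine ⟨l, fun I hI => by rw [hl I (hCD hI), if_pos hI], fun I hI => ?_⟩
  by_cases h : I ∈ D
  · rw [hl I h, if_neg hI]; linarith
  · refine hD.lt_lowerSetHeight l (fun J hJ => ?_) (fun J hJ => ?_) I h <;>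
      rw [hl J hJ] <;> split_ifs <;> linarith

end LowerSets


theorem integerLattice_le_of_single_mem {P : Type*} [Fintype P] [DecidableEq P] {G : AddSubgroup (P → ℝ)}
    (h : ∀ p, (Pi.single p 1 : P → ℝ) ∈ G) : integerLattice P ≤ G := by
  intro x hx
  choose n hn using hx
  have : x = ∑ p, n p • (Pi.single p 1 : P → ℝ) := by
    ext q
    simp [Finset.sum_apply, Pi.single_apply, hn]
  rw [this]
  exact G.sum_mem fun p _ => G.zsmul_mem (h p) _

theorem vertexPoint_mem_integerLattice {P : Type*} [PartialOrder P] (I : LowerSet P) : vertexPoint I ∈ integerLattice P :=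
  fun p => by
    by_cases h : Maximal (· ∈ I) p
    · exact ⟨1, by simp [vertexPoint_of_maximal h]⟩
    · exact ⟨0, by simp [vertexPoint_of_not_maximal h]⟩

/-! ### Lattice points, greedy decomposition, lattice generation -/

section ChainPolytope

variable {P : Type*} [PartialOrder P] [Fintype P]

theorem sum_le_one_of_mem_chainPolytope {a : P → ℝ} (ha : a ∈ chainPolytope P) (c : Finset P)
    (hc : IsChain (· ≤ ·) (c : Set P)) : ∑ i ∈ c, a i ≤ 1 := by
  classical
  obtain ⟨D, hD, hcD⟩ := hc.exists_maxChain
  refine le_trans ?_ (ha.2 D.toFinite.toFinset (by simpa using hD))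
  exact Finset.sum_le_sum_of_subset_of_nonneg (fun x hx => by simpa using hcD hx)
    fun i _ _ => ha.1 i

theorem convex_chainPolytope : Convex ℝ (chainPolytope P) := by
  intro x hx y hy a b ha hb hab
  refine ⟨fun i => add_nonneg (mul_nonneg ha (hx.1 i)) (mul_nonneg hb (hy.1 i)), fun c hc => ?_⟩
  simp only [Pi.add_apply, Pi.smul_apply, smul_eq_mul, Finset.sum_add_distrib, ← Finset.mul_sum]
  nlinarith [hx.2 c hc, hy.2 c hc]

theorem vertexPoint_mem_chainPolytope (I : LowerSet P) : vertexPoint I ∈ chainPolytope P := by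
  refine ⟨vertexPoint_nonneg I, fun c hc => ?_⟩
  by_cases h : ∃ p ∈ c, Maximal (· ∈ I) p
  · obtain ⟨p, hpc, hp⟩ := h
    rw [Finset.sum_eq_single_of_mem p hpc fun q hq hqp => ?_, vertexPoint_of_maximal hp]
    refine vertexPoint_of_not_maximal fun hqm => hqp ?_
    rcases hc.isChain.total hq hpc with h | h
    · exact hqm.eq_of_le hp.1 h
    · exact (hp.eq_of_le hqm.1 h).symm
  · push Not at h
    rw [Finset.sum_eq_zero fun q hq => vertexPoint_of_not_maximal (h q hq)]
    exact zero_le_one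

/-- The chains `{p}` force integral coordinates to be 0 or 1, and the chains `{p, q}` force the
support to be an antichain. -/
theorem latticePoints_chainPolytope :
    latticePoints (chainPolytope P) = Set.range (vertexPoint : LowerSet P → P → ℝ) := by
  classical
  ext x
  constructor
  · rintro ⟨hx, hint⟩
    have h01 : ∀ p, x p ≠ 0 → x p = 1 := fun p hp => by
      have h1 := sum_le_one_of_mem_chainPolytope hx {p} (by simp)
      have h0 := hx.1 p
      obtain ⟨n, hn⟩ := hint p
      rw [Finset.sum_singleton] at h1
      rw [hn] at h0 h1 hp ⊢
      norm_cast at h0 h1 hp ⊢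
      omega
    have hanti : IsAntichain (· ≤ ·) {p | x p ≠ 0} := fun p hp q hq hne hpq => by
      have h := sum_le_one_of_mem_chainPolytope hx {p, q} (by simpa using IsChain.pair hpq)
      rw [Finset.sum_pair hne, h01 p hp, h01 q hq] at h
      norm_num at h
    refine ⟨lowerClosure {p | x p ≠ 0}, funext fun p => ?_⟩
    rw [vertexPoint_lowerClosure hanti]
    split_ifs with h
    · exact (h01 p h).symm
    · exact (not_not.1 h).symm
  · rintro ⟨I, rfl⟩
    exact ⟨vertexPoint_mem_chainPolytope I, vertexPoint_mem_integerLattice I⟩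

/-- A nonnegative vector whose chain sums are at most `M` is a nonnegative combination of total
weight `M` of the points of a chain of lower sets. -/
theorem exists_chain_decomposition [Fintype (LowerSet P)] (n : ℕ) (a : P → ℝ) (M : ℝ) (hM : 0 ≤ M)
    (hn : {p | a p ≠ 0}.ncard ≤ n) (ha : ∀ p, 0 ≤ a p)
    (hc : ∀ c : Finset P, IsChain (· ≤ ·) (c : Set P) → ∑ i ∈ c, a i ≤ M) :
    ∃ w : LowerSet P → ℝ, (∀ I, 0 ≤ w I) ∧ ∑ I, w I = M ∧ ∑ I, w I • vertexPoint I = a ∧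
      IsChain (· ≤ ·) {I | w I ≠ 0} ∧ ∀ I, w I ≠ 0 → I ≤ lowerClosure {p | a p ≠ 0} := by
  classical
  induction n generalizing a M with
  | zero =>
    have h0 : ∀ p, a p = 0 := fun p => by
      by_contra hp
      have : {p | a p ≠ 0} = ∅ := (Set.ncard_eq_zero).1 (Nat.le_zero.1 hn)
      exact this.subset hp
    have hbot : ∀ I, (Pi.single ⊥ M : LowerSet P → ℝ) I ≠ 0 → I = ⊥ := fun I hI => by
      by_contra h
      exact hI (by simp [h])
    have h1 : (0 : LowerSet P → ℝ) ≤ Pi.single ⊥ M := Pi.single_nonneg.2 hM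
    -- Here `a = 0`; the leftover weight goes to `⊥`, whose point is the origin.
    refine ⟨Pi.single ⊥ M, h1, by simp, ?_, ?_,
      fun I hI => hbot I hI ▸ bot_le⟩
    · rw [Finset.sum_eq_single ⊥ (fun I _ hI => by rw [Pi.single_eq_of_ne hI, zero_smul])
        (by simp), vertexPoint_bot, smul_zero]
      exact (funext h0).symm
    · exact Set.Subsingleton.isChain fun I hI J hJ => (hbot I hI).trans (hbot J hJ).symm
  | succ n ih =>
    set S : Set P := {p | a p ≠ 0} with hS
    rcases S.eq_empty_or_nonempty with hemp | hne
    · exact ih a M hM (by rw [← hS, hemp]; simp) ha hc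
    set I₀ : LowerSet P := lowerClosure S with hI₀
    have hmaxS : ∀ p, Maximal (· ∈ I₀) p → p ∈ S := by
      rintro p ⟨⟨q, hq, hpq⟩, h⟩
      have : q ≤ p := h (subset_lowerClosure hq) hpq
      exact le_antisymm hpq this ▸ hq
    have hpos : ∀ p ∈ S, 0 < a p := fun p hp => lt_of_le_of_ne (ha p) (Ne.symm hp)
    -- Subtracting the least value on the maximal elements of `I₀` keeps `a` nonnegative and removes
    -- `q₀` from the support.
    obtain ⟨q₀, hq₀, hmin⟩ := (Set.toFinite {p | Maximal (· ∈ I₀) p}).exists_minimalFor a _ (by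
      obtain ⟨p, hp⟩ := hne
      obtain ⟨q, -, hq⟩ := exists_maximal_ge_of_mem (I := I₀) (subset_lowerClosure hp)
      exact ⟨q, hq⟩)
    have hle : ∀ p, Maximal (· ∈ I₀) p → a q₀ ≤ a p := fun p hp =>
      (le_total (a q₀) (a p)).elim id fun h => hmin hp h
    set ε := a q₀ with hε
    have hε0 : 0 < ε := hpos _ (hmaxS _ hq₀)
    set b : P → ℝ := a - ε • vertexPoint I₀ with hb
    have hbmax : ∀ p, Maximal (· ∈ I₀) p → b p = a p - ε := fun p hp => by
      simp [hb, vertexPoint_of_maximal hp]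
    have hbnot : ∀ p, ¬ Maximal (· ∈ I₀) p → b p = a p := fun p hp => by
      simp [hb, vertexPoint_of_not_maximal hp]
    have hb0 : ∀ p, 0 ≤ b p := fun p => by
      by_cases hp : Maximal (· ∈ I₀) p
      · rw [hbmax p hp]; linarith [hle p hp]
      · rw [hbnot p hp]; exact ha p
    have hbS : {p | b p ≠ 0} ⊂ S := by
      refine ⟨fun p hp => ?_, fun h => h (hmaxS _ hq₀) ?_⟩
      · by_cases hpm : Maximal (· ∈ I₀) p
        · exact hmaxS p hpm
        · exact fun h => hp ((hbnot p hpm).trans h)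
      · rw [hbmax _ hq₀, sub_self]
    have hεM : ε ≤ M := by simpa using hc {q₀} (by simp)
    have hbc : ∀ c : Finset P, IsChain (· ≤ ·) (c : Set P) → ∑ i ∈ c, b i ≤ M - ε := by
      intro c hcc
      by_cases hex : ∃ p ∈ c, Maximal (· ∈ I₀) p
      · obtain ⟨p, hpc, hp⟩ := hex
        have hv : vertexPoint I₀ p ≤ ∑ i ∈ c, vertexPoint I₀ i :=
          Finset.single_le_sum (fun i _ => vertexPoint_nonneg I₀ i) hpc
        rw [vertexPoint_of_maximal hp] at hv
        simp only [hb, Pi.sub_apply, Pi.smul_apply, smul_eq_mul, Finset.sum_sub_distrib,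
          ← Finset.mul_sum]
        nlinarith [hc c hcc]
      · push Not at hex
        rw [Finset.sum_congr rfl fun p hp => hbnot p (hex p hp)]
        -- A chain avoiding the maximal elements of `I₀`, cut down to the support, can be extended
        -- on top by such an element `q`. As `a q ≥ ε`, its own sum is at most `M - ε`.
        rw [← Finset.sum_filter_ne_zero]
        set d := c.filter fun p => a p ≠ 0 with hd
        have hdc : IsChain (· ≤ ·) (d : Set P) := hcc.mono (Finset.coe_subset.2 (Finset.filter_subset _ _))
        rcases d.eq_empty_or_nonempty with hde | hdne
        · rw [hde, Finset.sum_empty]; linarith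
        obtain ⟨t, ht⟩ := d.exists_maximal hdne
        have htS : t ∈ S := (Finset.mem_filter.1 ht.1).2
        obtain ⟨q, htq, hq⟩ := exists_maximal_ge_of_mem (I := I₀) (subset_lowerClosure htS)
        have hqd : q ∉ d := fun h => hex q (Finset.mem_filter.1 h).1 hq
        have hle' : ∀ i ∈ d, i ≤ q := fun i hi => by
          rcases hdc.total hi ht.1 with h | h
          · exact h.trans htq
          · exact (ht.2 hi h).trans htq
        have := hc (insert q d) (by
          rw [Finset.coe_insert]
          exact hdc.insert fun i hi _ => Or.inr (hle' i hi))
        rw [Finset.sum_insert hqd] at this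
        linarith [hle q hq]
    obtain ⟨w, hw0, hwM, hwa, hwc, hwI⟩ := ih b (M - ε) (by linarith)
      (by have := Set.ncard_lt_ncard hbS; omega) hb0 hbc
    have hwle : ∀ I, w I ≠ 0 → I ≤ I₀ := fun I hI =>
      (hwI I hI).trans (lowerClosure_mono hbS.subset)
    have hsupp : ∀ I, (w + Pi.single I₀ ε : LowerSet P → ℝ) I ≠ 0 → I = I₀ ∨ w I ≠ 0 := fun I hI => by
      by_contra! h
      exact hI (by simp [h.1, h.2])
    have h1 : (0 : LowerSet P → ℝ) ≤ Pi.single I₀ ε := Pi.single_nonneg.2 hε0.le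
    refine ⟨w + Pi.single I₀ ε, fun I => add_nonneg (hw0 I) (h1 I),
      ?_, ?_, ?_, ?_⟩
    · simp [Finset.sum_add_distrib, hwM]
    · simp only [Pi.add_apply, add_smul, Finset.sum_add_distrib, hwa]
      rw [Finset.sum_eq_single I₀ (fun I _ hI => by rw [Pi.single_eq_of_ne hI, zero_smul])
        (by simp), Pi.single_eq_same, hb, sub_add_cancel]
    · refine (hwc.insert (a := I₀) fun I hI _ => Or.inr (hwle I hI)).mono fun I hI => ?_
      exact hsupp I hI
    · intro I hI
      rcases hsupp I hI with rfl | h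
      · exact le_rfl
      · exact hwle I h

/-- The points of a maximal chain of lower sets generate the integer lattice. -/
theorem IsMaxChain.integerLattice_le {C : Set (LowerSet P)} (hC : IsMaxChain (· ≤ ·) C)
    {G : AddSubgroup (P → ℝ)} (hG : ∀ I ∈ C, vertexPoint I ∈ G) : integerLattice P ≤ G := by
  classical
  suffices h : ∀ B : LowerSet P, B ∈ C → ∀ p ∈ B, (Pi.single p 1 : P → ℝ) ∈ G from
    integerLattice_le_of_single_mem fun p => h ⊤ hC.top_mem p (by simp)
  intro B
  induction B using WellFoundedLT.induction with
  | ind B ih =>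
  intro hB p hpB
  have hne : B ≠ ⊥ := by rintro rfl; simp at hpB
  obtain ⟨J, hJC, hJB, hcov⟩ := hC.exists_pred hB hne
  have hJ := ih J hJB hJC
  by_cases hpJ : p ∈ J
  · exact hJ p hpJ
  -- Adding to `J` the elements below `p` already fills `B`, so any two elements of `B` outside `J`
  -- are below each other.
  have hbelow : ∀ p ∈ B, p ∉ J → ∀ q ∈ B, q ∉ J → q ≤ p := fun p hpB hpJ q hqB hqJ => by
    have h := hcov (J ⊔ LowerSet.Iic p) le_sup_left (sup_le hJB.le (LowerSet.Iic_le.2 hpB))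
    have h' : J ⊔ LowerSet.Iic p = B := h.resolve_left fun h =>
      hpJ (LowerSet.Iic_le.1 (sup_eq_left.1 h))
    rw [← h', LowerSet.mem_sup_iff] at hqB
    exact hqB.resolve_left hqJ
  have huniq : ∀ q ∈ B, q ∉ J → q = p := fun q hqB hqJ =>
    le_antisymm (hbelow p hpB hpJ q hqB hqJ) (hbelow q hqB hqJ p hpB hpJ)
  have hpmax : Maximal (· ∈ B) p := by
    refine ⟨hpB, fun q hqB hpq => ?_⟩
    rw [huniq q hqB fun hqJ => hpJ (J.lower hpq hqJ)]
  -- The other maximal elements of `B` lie in `J`, where the induction hypothesis applies.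
  have hdecomp : (Pi.single p 1 : P → ℝ) = vertexPoint B -
      ∑ q ∈ Finset.univ.filter (fun q => q ∈ J ∧ Maximal (· ∈ B) q), Pi.single q 1 := by
    ext r
    simp only [Pi.sub_apply, Finset.sum_apply, Pi.single_apply, Finset.sum_ite_eq,
      Finset.mem_filter, Finset.mem_univ, true_and]
    by_cases hr : r = p
    · subst hr
      simp [hpJ, vertexPoint_of_maximal hpmax]
    · by_cases hrB : Maximal (· ∈ B) r
      · have : r ∈ J := by
          by_contra h
          exact hr (huniq r hrB.1 h)
        simp [hr, hrB, this, vertexPoint_of_maximal hrB]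
      · simp [hr, hrB, vertexPoint_of_not_maximal hrB]
  rw [hdecomp]
  exact G.sub_mem (hG B hB) (G.sum_mem fun q hq => hJ q (Finset.mem_filter.1 hq).2.1)

end ChainPolytope


/-! ### The simplicial complex of chains and its properties -/

section Triangulation

/-- Height functions cutting out sets by affine functions force these sets to glue properly. -/
theorem convexHull_inter_subset_of_support {E : Type*} [AddCommGroup E] [Module ℝ E]
    {s t : Finset E} (ω : E → ℝ)
    (hs : ∃ l : E →ᵃ[ℝ] ℝ, (∀ x ∈ s, l x = ω x) ∧ ∀ x ∈ t, x ∉ s → l x < ω x)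
    (ht : ∃ l : E →ᵃ[ℝ] ℝ, (∀ x ∈ t, l x = ω x) ∧ ∀ x ∈ s, x ∉ t → l x < ω x) :
    convexHull ℝ (s : Set E) ∩ convexHull ℝ (t : Set E) ⊆ convexHull ℝ (s ∩ t : Set E) := by
  classical
  rintro x ⟨hxs, hxt⟩
  obtain ⟨u, hu0, hu1, hux⟩ := Finset.mem_convexHull'.1 hxs
  obtain ⟨v, hv0, hv1, hvx⟩ := Finset.mem_convexHull'.1 hxt
  have key : ∀ (l : E →ᵃ[ℝ] ℝ) (r : Finset E) (w : E → ℝ), ∑ y ∈ r, w y = 1 →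
      ∑ y ∈ r, w y • y = x → l x = ∑ y ∈ r, w y * l y := fun l r w hw hwx => by
    have hdec : ∀ z, l z = l.linear z + l 0 := fun z => congrFun l.decomp z
    rw [hdec x, ← hwx, map_sum]
    conv_rhs => enter [2, y]; rw [hdec y, mul_add]
    rw [Finset.sum_add_distrib, ← Finset.sum_mul, hw, one_mul]
    simp
  have hle : ∀ (l : E →ᵃ[ℝ] ℝ) (r : Finset E) (w : E → ℝ), (∀ y ∈ r, 0 ≤ w y) →
      (∀ y ∈ r, l y ≤ ω y) → ∀ y ∈ r, w y * l y ≤ w y * ω y := fun l r w hw h y hy =>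
    mul_le_mul_of_nonneg_left (h y hy) (hw y hy)
  obtain ⟨l, hls, hlt⟩ := hs
  obtain ⟨m, hmt, hms⟩ := ht
  have hlt' : ∀ y ∈ t, l y ≤ ω y := fun y hy => by
    by_cases h : y ∈ s
    · exact (hls y h).le
    · exact (hlt y hy h).le
  have hms' : ∀ y ∈ s, m y ≤ ω y := fun y hy => by
    by_cases h : y ∈ t
    · exact (hmt y h).le
    · exact (hms y hy h).le
  have e1 : ∑ y ∈ s, u y * ω y = l x := by
    rw [key l s u hu1 hux]; exact Finset.sum_congr rfl fun y hy => by rw [hls y hy]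
  have e2 : ∑ y ∈ t, v y * ω y = m x := by
    rw [key m t v hv1 hvx]; exact Finset.sum_congr rfl fun y hy => by rw [hmt y hy]
  -- The two inequalities show that both combinations of heights agree, so `v` has no weight where
  -- `l` is strictly below `ω`, that is, off `s`.
  have i1 : l x ≤ ∑ y ∈ t, v y * ω y := by
    rw [key l t v hv1 hvx]; exact Finset.sum_le_sum (hle l t v hv0 hlt')
  have i2 : m x ≤ ∑ y ∈ s, u y * ω y := by
    rw [key m s u hu1 hux]; exact Finset.sum_le_sum (hle m s u hu0 hms')
  have heq : ∑ y ∈ t, v y * l y = ∑ y ∈ t, v y * ω y := by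
    rw [← key l t v hv1 hvx]; linarith
  have hzero : ∀ y ∈ t, y ∉ s → v y = 0 := fun y hy hys => by
    have := (Finset.sum_eq_sum_iff_of_le (hle l t v hv0 hlt')).1 heq y hy
    by_contra hne
    exact (hlt y hy hys).ne (mul_left_cancel₀ hne this)
  have hsub : s ∩ t ⊆ t := Finset.inter_subset_right
  have hz : ∀ y ∈ t, y ∉ s ∩ t → v y = 0 := fun y hy h =>
    hzero y hy fun hys => h (Finset.mem_inter.2 ⟨hys, hy⟩)
  rw [← Finset.coe_inter, Finset.mem_convexHull']
  refine ⟨v, fun y hy => hv0 y (hsub hy), ?_, ?_⟩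
  · rw [Finset.sum_subset hsub hz, hv1]
  · rw [Finset.sum_subset hsub fun y hy h => by rw [hz y hy h, zero_smul], hvx]

/-- A set on which affine functions take arbitrary values is affinely independent. -/
theorem affineIndependent_of_exists_affineMap {E : Type*} [AddCommGroup E] [Module ℝ E]
    {s : Set E} (h : ∀ g : E → ℝ, ∃ l : E →ᵃ[ℝ] ℝ, ∀ x ∈ s, l x = g x) :
    AffineIndependent ℝ ((↑) : s → E) := by
  classical
  rw [affineIndependent_iff]
  intro t w hw hwx y hy
  -- Applying to the dependence an `l` that is 1 at `y` and 0 on the rest of `s` isolates `w y`.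
  obtain ⟨l, hl⟩ := h (Pi.single (y : E) 1)
  have hdec : ∀ z, l z = l.linear z + l 0 := fun z => congrFun l.decomp z
  have h1 : ∑ z ∈ t, w z * l z = 0 := by
    have h2 := congrArg l.linear hwx
    rw [map_sum, map_zero] at h2
    conv_lhs => enter [2, z]; rw [hdec z, mul_add]
    rw [Finset.sum_add_distrib, ← Finset.sum_mul, hw, zero_mul, add_zero, ← h2]
    simp
  rw [Finset.sum_eq_single_of_mem y hy fun z _ hz => by
    rw [hl z z.2, Pi.single_eq_of_ne (Subtype.coe_ne_coe.2 hz), mul_zero], hl y y.2] at h1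
  simpa using h1

variable {P : Type*} [PartialOrder P] [Fintype P]

/-- The height of a point, namely that of the lower set generated by its support. -/
noncomputable def pointHeight (x : P → ℝ) : ℝ := lowerSetHeight (lowerClosure {p | x p ≠ 0})

theorem pointHeight_vertexPoint (I : LowerSet P) :
    pointHeight (vertexPoint I) = lowerSetHeight I := by
  rw [pointHeight, lowerClosure_vertexPoint_ne_zero]

variable (P) in
/-- The vertex sets given by the nonempty chains of lower sets. -/
def chainFaces : Set (Finset (P → ℝ)) :=
  {s | s.Nonempty ∧ (s : Set (P → ℝ)) ⊆ Set.range vertexPoint ∧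
    IsChain (· ≤ ·) {I : LowerSet P | vertexPoint I ∈ s}}

theorem exists_support_of_mem_chainFaces {s : Finset (P → ℝ)} (hs : s ∈ chainFaces P) :
    ∃ l : (P → ℝ) →ᵃ[ℝ] ℝ, (∀ x ∈ s, l x = pointHeight x) ∧
      ∀ x ∈ Set.range (vertexPoint : LowerSet P → P → ℝ), x ∉ s → l x < pointHeight x := by
  obtain ⟨l, hl, hlt⟩ := hs.2.2.exists_support
  refine ⟨l, fun x hx => ?_, ?_⟩
  · obtain ⟨I, rfl⟩ := hs.2.1 hx
    rw [pointHeight_vertexPoint]; exact hl I hx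
  · rintro _ ⟨I, rfl⟩ hI
    rw [pointHeight_vertexPoint]; exact hlt I hI

theorem image_vertexPoint_mem_chainFaces [DecidableEq (P → ℝ)] {C : Finset (LowerSet P)}
    (hne : C.Nonempty) (hC : IsChain (· ≤ ·) (C : Set (LowerSet P))) :
    C.image vertexPoint ∈ chainFaces P := by
  refine ⟨hne.image _, by simp, ?_⟩
  convert hC using 1
  ext I
  simp [vertexPoint_injective.eq_iff]

variable (P) in
/-- The triangulation of the chain polytope whose simplices are the chains of lower sets. -/
noncomputable def chainTriangulation : Geometry.SimplicialComplex ℝ (P → ℝ) where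
  faces := chainFaces P
  isRelLowerSet_faces := fun s hs => ⟨hs.1, fun t hts ht =>
    ⟨ht, fun x hx => hs.2.1 (hts hx), hs.2.2.mono fun I hI => hts hI⟩⟩
  indep := fun {s} hs => affineIndependent_of_exists_affineMap (s := (s : Set (P → ℝ))) fun g => by
    obtain ⟨l, hl⟩ := exists_affineMap_vertexPoint_eq (Set.toFinite _).toFinset
      (by simpa using hs.2.2) fun I => g (vertexPoint I)
    refine ⟨l, fun x hx => ?_⟩
    obtain ⟨I, rfl⟩ := hs.2.1 hx
    exact hl I (by simpa using hx)
  inter_subset_convexHull := fun {s t} hs ht => by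
    obtain ⟨l, hl, hlt⟩ := exists_support_of_mem_chainFaces hs
    obtain ⟨m, hm, hmt⟩ := exists_support_of_mem_chainFaces ht
    exact convexHull_inter_subset_of_support pointHeight
      ⟨l, hl, fun x hx => hlt x (ht.2.1 hx)⟩ ⟨m, hm, fun x hx => hmt x (hs.2.1 hx)⟩

theorem chainTriangulation_space : (chainTriangulation P).space = chainPolytope P := by
  classical
  ext a
  rw [Geometry.SimplicialComplex.mem_space_iff]
  constructor
  · rintro ⟨s, hs, has⟩
    refine convexHull_min (fun x hx => ?_) convex_chainPolytope has
    obtain ⟨I, rfl⟩ := hs.2.1 hx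
    exact vertexPoint_mem_chainPolytope I
  · intro ha
    have := Fintype.ofFinite (LowerSet P)
    obtain ⟨w, hw0, hw1, hwa, hwc, -⟩ := exists_chain_decomposition _ a 1 zero_le_one le_rfl ha.1
      (sum_le_one_of_mem_chainPolytope ha)
    set C : Finset (LowerSet P) := Finset.univ.filter fun I => w I ≠ 0 with hC
    have hC1 : ∑ I ∈ C, w I = 1 := by rw [hC, Finset.sum_filter_ne_zero, hw1]
    have hCa : ∑ I ∈ C, w I • vertexPoint I = a := by
      rw [← hwa, hC]
      refine Finset.sum_filter_of_ne fun I _ h hI => h ?_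
      rw [hI, zero_smul]
    have hne : C.Nonempty := by
      by_contra h
      rw [Finset.not_nonempty_iff_eq_empty.1 h] at hC1
      simp at hC1
    refine ⟨_, image_vertexPoint_mem_chainFaces hne (by simpa [hC] using hwc), ?_⟩
    rw [← hCa]
    exact (convex_convexHull ℝ _).sum_mem (fun I _ => hw0 I) hC1 fun I hI =>
      subset_convexHull ℝ _ (Finset.mem_coe.2 (Finset.mem_image_of_mem _ hI))

theorem isTriangulation_chainTriangulation :
    IsTriangulation (chainPolytope P) (chainTriangulation P) where
  finite := by
    refine ((Set.finite_range (vertexPoint : LowerSet P → P → ℝ)).finite_subsets.preimage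
      (Finset.coe_injective.injOn)).subset fun s hs => hs.2.1
  space_eq := chainTriangulation_space
  vertices_subset := fun x hx => by
    rw [latticePoints_chainPolytope]
    exact hx.2.1 (by simp)

theorem isRegularTriangulation_chainTriangulation :
    IsRegularTriangulation (latticePoints (chainPolytope P)) (chainTriangulation P) := by
  rw [latticePoints_chainPolytope]
  refine ⟨pointHeight, fun s => ⟨fun hs => ⟨hs.1, hs.2.1, exists_support_of_mem_chainFaces hs⟩, ?_⟩⟩
  rintro ⟨hne, hsub, l, hl, hlt⟩
  refine ⟨hne, hsub, fun I hI J hJ _ => ?_⟩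
  by_contra! hcon
  have hle : ∀ K : LowerSet P, l (vertexPoint K) ≤ lowerSetHeight K := fun K => by
    rw [← pointHeight_vertexPoint]
    by_cases h : vertexPoint K ∈ s
    · exact (hl _ h).le
    · exact (hlt _ ⟨K, rfl⟩ h).le
  -- If `I` and `J` were incomparable, `l` would reach the heights at both, while the strictly
  -- smaller heights at `I ⊔ J` and `K` bound the same sum.
  obtain ⟨K, hK, hadd⟩ := exists_vertexPoint_add_eq I J
  have hht := lowerSetHeight_add_le hcon.1 hcon.2 hK
  have h1 := hl _ hI
  have h2 := hl _ hJ
  rw [pointHeight_vertexPoint] at h1 h2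
  have := l.map_add_eq_of_add_eq hadd
  linarith [hle (I ⊔ J), hle K]

/-- A facet is a maximal chain, which contains `⊥`; as its point is 0, the differences include the
vertices themselves. -/
theorem isUnimodular_chainTriangulation : IsUnimodular (chainTriangulation P) := by
  classical
  rintro s ⟨hs, hmax⟩
  have hlat : (s : Set (P → ℝ)) ⊆ integerLattice P := fun x hx => by
    obtain ⟨I, rfl⟩ := hs.2.1 hx
    exact vertexPoint_mem_integerLattice I
  refine ⟨hlat, le_antisymm ?_ ?_⟩
  · rw [AddSubgroup.closure_le]
    rintro _ ⟨v, hv, w, hw, rfl⟩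
    exact (integerLattice P).sub_mem (hlat hv) (hlat hw)
  obtain ⟨D, hD, hCD⟩ := hs.2.2.exists_maxChain
  have hface : D.toFinite.toFinset.image vertexPoint ∈ chainFaces P :=
    image_vertexPoint_mem_chainFaces ⟨⊥, by simpa using hD.bot_mem⟩ (by simpa using hD.isChain)
  have hsD : s = D.toFinite.toFinset.image vertexPoint := hmax hface fun x hx => by
    obtain ⟨I, rfl⟩ := hs.2.1 hx
    exact Finset.mem_image_of_mem _ (by simpa using hCD hx)
  have hmem : ∀ I ∈ D, vertexPoint I ∈ s := fun I hI => by
    rw [hsD]; exact Finset.mem_image_of_mem _ (by simpa using hI)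
  refine hD.integerLattice_le fun I hI => AddSubgroup.subset_closure
    ⟨_, hmem I hI, _, hmem ⊥ hD.bot_mem, ?_⟩
  rw [vertexPoint_bot, sub_zero]

/-- Being a chain is a condition on pairs. -/
theorem isFlag_chainTriangulation : IsFlag (chainTriangulation P) := by
  intro s hne h
  refine ⟨hne, fun v hv => ?_, fun I hI J hJ hIJ => ?_⟩
  · obtain ⟨e, he, hve, -⟩ := h v hv v hv
    exact he.2.1 hve
  · obtain ⟨e, he, hIe, hJe⟩ := h _ hI _ hJ
    exact he.2.2 hIe hJe hIJ

end Triangulation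

theorem corollary3p1 (P : Type*) [PartialOrder P] [Fintype P] :
    ∃ K : Geometry.SimplicialComplex ℝ (P → ℝ),
      IsTriangulation (chainPolytope P) K ∧
      IsRegularTriangulation (latticePoints (chainPolytope P)) K ∧
      IsUnimodular K ∧
      IsFlag K :=
  ⟨chainTriangulation P, isTriangulation_chainTriangulation,
    isRegularTriangulation_chainTriangulation, isUnimodular_chainTriangulation,
    isFlag_chainTriangulation⟩
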